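/- Let $N\ge 1$ and let $\Sigma=(A,B,C)\in\mathbb R^{n\times n}\times\mathbb R^{n\times m}\times\mathbb R^{p\times n}$. Write $\mathrm{He}\{M\}=M^T+M$, and $M\succ0$ ($M\prec 0$) for "symmetric positive (negative) definite". Let $\mathbf e_{(N,i)}$ be the $i$-th unit vector of $\mathbb R^N$, $\mathcal L_k=[\,\mathbf I_k\ \mathbf 0\,]$, $\mathcal R_k=[\,\mathbf 0\ \mathbf I_k\,]\in\mathbb R^{k\times(k+1)}$, $\mathbf T_N$ the $N\times N$ matrix with ones on the anti-diagonal and zeros elsewhere, and $\lceil k\rceil_N$ the remainder of $k$ modulo $N$. For gains $F^{(a,i)}\in\mathbb R^{m\times p}$ ($0\le i\le a\le N-1$) let $\mathcal F$ be the block lower triangular matrix in $\mathbb R^{Nm\times Np}$ whose block in row $r$ and column $s$ ($0\le s\le r\le N-1$) is $F^{(r,r-s)}$. The associated $N$-periodic control system is $$x(k+1)=Ax(k)+B\sum_{i=0}^{\lceil k\rceil_N}F^{(\lceil k\rceil_N,i)}Cx(k-i),$$ and $\mathcal A_{\rm LTI}(\mathcal F,\Sigma)$ is the $n\times n$ matrix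 with $x(k+N)=\mathcal A_{\rm LTI}(\mathcal F,\Sigma)x(k)$ whenever $N\mid k$; the equivalent LTI system is $\phi(t+1)=\mathcal A_{\rm LTI}(\mathcal F,\Sigma)\phi(t)$. It is computed recursively: with $\mathcal F^{(\delta)}$ the leading $\delta\times\delta$ blocks of $\mathcal F$ and $\Phi_0=\mathbf I_n$, for $\delta=1,\dots,N$ put $\mathcal A_\delta=[\,\mathbf 0\ \mathbf I_n\,]\big(\mathbf I_\delta\otimes A+(\mathbf I_\delta\otimes B)\mathcal F^{(\delta)}(\mathbf I_\delta\otimes C)\big)\Phi_{\delta-1}$ and $\Phi_\delta=\begin{bmatrix}\Phi_{\delta-1}\\ \mathcal A_\delta\end{bmatrix}$; then $\mathcal A_{\rm LTI}(\mathcal F,\Sigma)=\mathcal A_N$. For state-feedback gain matrices $\mathcal F\in\mathbb R^{Nm\times Nn}$ the same is used with $C=\mathbf I_n$. Put $\mathcal P(\mathcal A)=\{P\succ0:\mathcal A^TP\mathcal A-P\prec0\}$, and let $\mathcal S_{\rm SOF}^{(N)}(\Sigma)$ be the union of $\mathcal P(\mathcal A_{\rm LTI}(\mathcal F,\Sigma))$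 over all block lower triangular $\mathcal F\in\mathbb R^{Nm\times Np}$ with $\rho(\mathcal A_{\rm LTI}(\mathcal F,\Sigma))<1$. Put further $$\mathcal X_N(P,1)=\big(-\mathbf e_{(N+1,1)}\mathbf e_{(N+1,1)}^T+\mathbf e_{(N+1,N+1)}\mathbf e_{(N+1,N+1)}^T\big)\otimes P,\qquad \Pi_N=\begin{bmatrix}\mathbf e_{(N,1)}^T\otimes\mathbf I_n&\mathbf 0\\ \mathbf I_N\otimes A&\mathbf I_N\otimes B\end{bmatrix},$$ $$\mathcal C(\mathcal F)=\begin{bmatrix}\mathcal F(\mathbf I_N\otimes C)&-\mathbf I_{Nm}\\ \mathcal L_{N-1}\otimes A-\mathcal R_{N-1}\otimes\mathbf I_n&\mathcal L_{N-1}\otimes B\end{bmatrix},\qquad \mathcal H(\mathcal F)=\begin{bmatrix}\mathcal F&-\mathbf I_{Nm}\\ \mathcal L_{N-1}\otimes A-\mathcal R_{N-1}\otimes\mathbf I_n&\mathcal L_{N-1}\otimes B\end{bmatrix}.$$ Assume: (a) $\hat P=\hat P^T\in\mathbb R^{n\times n}$ and the block upper triangular matrices $\hat{\mathcal G}\in\mathbb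 R^{Nn\times Nn}$ (blocks $n\times n$), $\hat{\mathcal J}\in\mathbb R^{Nm\times Nn}$ (blocks $m\times n$) satisfy Ebihara's LMI $$\mathcal X_N(\hat P,1)+\mathrm{He}\{(\mathcal L_N^T\otimes A)\hat{\mathcal G}(\mathcal R_N\otimes\mathbf I_n)+(\mathcal L_N^T\otimes B)\hat{\mathcal J}(\mathcal R_N\otimes\mathbf I_n)-(\mathcal R_N^T\otimes\mathbf I_n)\hat{\mathcal G}(\mathcal R_N\otimes\mathbf I_n)\}\prec0,$$ and $\hat{\mathcal F}_{\rm SF}=(\mathbf T_N\otimes\mathbf I_m)\hat{\mathcal J}\hat{\mathcal G}^{-1}(\mathbf T_N\otimes\mathbf I_n)$; (b) $\mathcal P(\mathcal A_{\rm LTI}(\hat{\mathcal F}_{\rm SF},(A,B,\mathbf I_n)))\cap\mathcal S_{\rm SOF}^{(N)}(\Sigma)\neq\emptyset$. Then there is a block lower triangular gain matrix $\mathcal F_{\rm SOF}\in\mathbb R^{Nm\times Np}$ for which the $N$-periodic control system is asymptotically stable if and only if there are a block lower triangular $\mathcal F_{\rm SOF}\in\mathbb R^{Nm\times Np}$, a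 symmetric $P\in\mathbb R^{n\times n}$ and a $\mathcal V\in\mathbb R^{((N-1)n+Nm)\times((N-1)n+Nm)}$ with $$P\succ0,\qquad \Pi_N^T\mathcal X_N(P,1)\Pi_N+\mathrm{He}\{\mathcal H(\hat{\mathcal F}_{\rm SF})^T\mathcal V\,\mathcal C(\mathcal F_{\rm SOF})\}\prec0;$$ the same equivalence holds with the equivalent LTI system in place of the $N$-periodic control system. Moreover, every $\mathcal F_{\rm SOF}$ for which these inequalities hold with some $P$ and $\mathcal V$ makes both the $N$-periodic control system and the equivalent LTI system asymptotically stable. -/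

import Mathlib

open scoped Kronecker Topology

namespace PeriodicSOF

/-- `He{M} = Mᵀ + M`. -/
def He {ι : Type*} (M : Matrix ι ι ℝ) : Matrix ι ι ℝ := M.transpose + M

/-- `M ≺ 0`: the real matrix `M` is symmetric negative definite. -/
def NegDef {ι : Type*} [Fintype ι] (M : Matrix ι ι ℝ) : Prop := (-M).PosDef

/-- The unit vector of dimension `N` with a `1` in the `i`-th component (components are counted
from `1`). -/
def unitVec (N i : ℕ) : Fin N → ℝ := fun j => if (j : ℕ) + 1 = i then 1 else 0

/-- The `k × l` matrix `[I 0]`; for `l = k + 1` this is the matrix `𝓛_k`. -/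
def matL (k l : ℕ) : Matrix (Fin k) (Fin l) ℝ :=
  Matrix.of fun i j => if (j : ℕ) = (i : ℕ) then 1 else 0

/-- For `l = k + 1` this is the `k × (k + 1)` matrix `𝓡_k = [0 I]`. -/
def matR (k l : ℕ) : Matrix (Fin k) (Fin l) ℝ :=
  Matrix.of fun i j => if (j : ℕ) = (i : ℕ) + 1 then 1 else 0

/-- The `N × N` matrix with ones on the anti-diagonal and zeros elsewhere. -/
def matT (N : ℕ) : Matrix (Fin N) (Fin N) ℝ :=
  Matrix.of fun i j => if (i : ℕ) + (j : ℕ) + 1 = N then 1 else 0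

variable {n m p N : ℕ}

/-! ### Closed-loop systems and asymptotic stability -/

/-- `x` is, from the initial time `k₀` on, a trajectory of the `N`-periodic control system
`x(k+1) = A x(k) + B ∑_{i=0}^{k mod N} F^{(k mod N, i)} C x(k-i)`.
(Only the gains `F a i` with `i ≤ a < N` occur.) -/
def IsTrajectory (N : ℕ) (A : Matrix (Fin n) (Fin n) ℝ) (B : Matrix (Fin n) (Fin m) ℝ)
    (C : Matrix (Fin p) (Fin n) ℝ) (F : ℕ → ℕ → Matrix (Fin m) (Fin p) ℝ)
    (k₀ : ℕ) (x : ℕ → Fin n → ℝ) : Prop :=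
  ∀ k, k₀ ≤ k → x (k + 1) = A.mulVec (x k) +
    B.mulVec (∑ i ∈ Finset.range (k % N + 1), (F (k % N) i).mulVec (C.mulVec (x (k - i))))

/-- Asymptotic stability of the origin of the `N`-periodic control system, for every initial time
`k₀`: Lyapunov stability and attractivity. The initial data at time `k₀` are the values
`x(k₀), …, x(k₀ - (k₀ mod N))` that the controller still remembers. -/
def PeriodicAsympStable (N : ℕ) (A : Matrix (Fin n) (Fin n) ℝ) (B : Matrix (Fin n) (Fin m) ℝ)
    (C : Matrix (Fin p) (Fin n) ℝ) (F : ℕ → ℕ → Matrix (Fin m) (Fin p) ℝ) : Prop :=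
  ∀ k₀ : ℕ,
    (∀ ε > 0, ∃ δ > 0, ∀ x : ℕ → Fin n → ℝ, IsTrajectory N A B C F k₀ x →
      (∀ i ≤ k₀ % N, ‖x (k₀ - i)‖ < δ) → ∀ k, k₀ ≤ k → ‖x k‖ < ε) ∧
    (∀ x : ℕ → Fin n → ℝ, IsTrajectory N A B C F k₀ x → Filter.Tendsto x Filter.atTop (𝓝 0))

/-- Asymptotic stability of the origin of the linear time-invariant system `φ(t+1) = 𝒜 φ(t)`. -/
def LTIAsympStable (𝒜 : Matrix (Fin n) (Fin n) ℝ) : Prop :=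
  (∀ ε > 0, ∃ δ > 0, ∀ φ : ℕ → Fin n → ℝ, (∀ t, φ (t + 1) = 𝒜.mulVec (φ t)) →
    ‖φ 0‖ < δ → ∀ t, ‖φ t‖ < ε) ∧
  (∀ φ : ℕ → Fin n → ℝ, (∀ t, φ (t + 1) = 𝒜.mulVec (φ t)) →
    Filter.Tendsto φ Filter.atTop (𝓝 0))

/-! ### The equivalent LTI system -/

/-- The block lower triangular gain matrix `𝓕^{(N,↓)}`: its block in row `r` and column `s`
(counted from `0`) is `F^{(r, r-s)}` if `s ≤ r`, and zero otherwise. -/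
def gainMatrix (N : ℕ) (F : ℕ → ℕ → Matrix (Fin m) (Fin p) ℝ) :
    Matrix (Fin N × Fin m) (Fin N × Fin p) ℝ :=
  Matrix.of fun r c =>
    if c.1 ≤ r.1 then F (r.1 : ℕ) ((r.1 : ℕ) - (c.1 : ℕ)) r.2 c.2 else 0

/-- `𝒜_AUG = I ⊗ A + (I ⊗ B) 𝓕 (I ⊗ C)`. -/
def augMatrix (A : Matrix (Fin n) (Fin n) ℝ) (B : Matrix (Fin n) (Fin m) ℝ)
    (C : Matrix (Fin p) (Fin n) ℝ) (𝓕 : Matrix (Fin N × Fin m) (Fin N × Fin p) ℝ) :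
    Matrix (Fin N × Fin n) (Fin N × Fin n) ℝ :=
  (1 : Matrix (Fin N) (Fin N) ℝ) ⊗ₖ A +
    ((1 : Matrix (Fin N) (Fin N) ℝ) ⊗ₖ B) * 𝓕 * ((1 : Matrix (Fin N) (Fin N) ℝ) ⊗ₖ C)

/-- The leading block submatrix, obtained by deleting the last block row and block column:
it takes `𝓕^{(δ+1,↓)}` to `𝓕^{(δ,↓)}`. -/
def leading {δ : ℕ} (𝓕 : Matrix (Fin (δ + 1) × Fin m) (Fin (δ + 1) × Fin p) ℝ) :
    Matrix (Fin δ × Fin m) (Fin δ × Fin p) ℝ :=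
  𝓕.submatrix (Prod.map Fin.castSucc id) (Prod.map Fin.castSucc id)

/-- The block column with the blocks `I, 𝒜_LTI(𝓕^{(1,↓)}), …, 𝒜_LTI(𝓕^{(δ,↓)})`, built
recursively: the new last block is `[0 I] 𝒜_AUG^{(δ,↓)}` times the previous block column. -/
def stateColumn (A : Matrix (Fin n) (Fin n) ℝ) (B : Matrix (Fin n) (Fin m) ℝ)
    (C : Matrix (Fin p) (Fin n) ℝ) :
    (δ : ℕ) → Matrix (Fin δ × Fin m) (Fin δ × Fin p) ℝ → Matrix (Fin (δ + 1) × Fin n) (Fin n) ℝ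
  | 0, _ => Matrix.of fun r c => (1 : Matrix (Fin n) (Fin n) ℝ) r.2 c
  | δ + 1, 𝓕 => Matrix.of fun r c =>
      Fin.lastCases (motive := fun _ => ℝ)
        ((augMatrix A B C 𝓕 * stateColumn A B C δ (leading 𝓕)) (Fin.last δ, r.2) c)
        (fun i => stateColumn A B C δ (leading 𝓕) (i, r.2) c) r.1

/-- `𝒜_LTI(𝓕, Σ)` for `Σ = (A, B, C)`: the matrix with `x(k+N) = 𝒜_LTI x(k)` for `N ∣ k`.
State feedback is the case `C = I`. -/
def ltiMatrix (A : Matrix (Fin n) (Fin n) ℝ) (B : Matrix (Fin n) (Fin m) ℝ)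
    (C : Matrix (Fin p) (Fin n) ℝ) (𝓕 : Matrix (Fin N × Fin m) (Fin N × Fin p) ℝ) :
    Matrix (Fin n) (Fin n) ℝ :=
  Matrix.of fun i j => stateColumn A B C N 𝓕 (Fin.last N, i) j

/-! ### Sets of Lyapunov matrices -/

/-- `𝒫(𝒜) = {P ≻ 0 : 𝒜ᵀ P 𝒜 - P ≺ 0}`. -/
def lyapunovSet (𝒜 : Matrix (Fin n) (Fin n) ℝ) : Set (Matrix (Fin n) (Fin n) ℝ) :=
  {P | P.PosDef ∧ NegDef (𝒜.transpose * P * 𝒜 - P)}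

/-- The set of all stabilizing gain matrices `𝓕^{(N,↓)}`, that is, those with
`ρ(𝒜_LTI(𝓕^{(N,↓)}, Σ)) < 1`. The spectral radius of a real matrix is taken over `ℂ`. -/
def stabilizingGains (N : ℕ) (A : Matrix (Fin n) (Fin n) ℝ) (B : Matrix (Fin n) (Fin m) ℝ)
    (C : Matrix (Fin p) (Fin n) ℝ) : Set (Matrix (Fin N × Fin m) (Fin N × Fin p) ℝ) :=
  {𝓕 | (∃ F : ℕ → ℕ → Matrix (Fin m) (Fin p) ℝ, 𝓕 = gainMatrix N F) ∧
    spectralRadius ℂ ((ltiMatrix A B C 𝓕).map Complex.ofReal) < 1}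

/-- `𝒮^{(N)}(Σ)`: all Lyapunov matrices that correspond to stabilizing gains. -/
def lyapunovUnion (N : ℕ) (A : Matrix (Fin n) (Fin n) ℝ) (B : Matrix (Fin n) (Fin m) ℝ)
    (C : Matrix (Fin p) (Fin n) ℝ) : Set (Matrix (Fin n) (Fin n) ℝ) :=
  ⋃ 𝓕 ∈ stabilizingGains N A B C, lyapunovSet (ltiMatrix A B C 𝓕)

/-! ### The matrix inequalities -/

/-- `𝒳_δ(P, γ) = (-γ e_{(N+1,1)} e_{(N+1,1)}ᵀ + e_{(N+1,δ+1)} e_{(N+1,δ+1)}ᵀ) ⊗ P`. -/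
def matX (N δ : ℕ) (P : Matrix (Fin n) (Fin n) ℝ) (γ : ℝ) :
    Matrix (Fin (N + 1) × Fin n) (Fin (N + 1) × Fin n) ℝ :=
  (-(γ • Matrix.vecMulVec (unitVec (N + 1) 1) (unitVec (N + 1) 1)) +
    Matrix.vecMulVec (unitVec (N + 1) (δ + 1)) (unitVec (N + 1) (δ + 1))) ⊗ₖ P

/-- `Π_N`: the block row `[e_{(N,1)}ᵀ ⊗ I  0]` on top of `[I ⊗ A  I ⊗ B]`. -/
def matPi (N : ℕ) (A : Matrix (Fin n) (Fin n) ℝ) (B : Matrix (Fin n) (Fin m) ℝ) :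
    Matrix (Fin (N + 1) × Fin n) ((Fin N × Fin n) ⊕ (Fin N × Fin m)) ℝ :=
  Matrix.of fun r c =>
    Fin.cases (motive := fun _ => ℝ)
      (Matrix.fromCols
        ((Matrix.of fun (_ : Fin 1) j => unitVec N 1 j) ⊗ₖ (1 : Matrix (Fin n) (Fin n) ℝ))
        (0 : Matrix (Fin 1 × Fin n) (Fin N × Fin m) ℝ) (0, r.2) c)
      (fun i => Matrix.fromCols
        ((1 : Matrix (Fin N) (Fin N) ℝ) ⊗ₖ A) ((1 : Matrix (Fin N) (Fin N) ℝ) ⊗ₖ B) (i, r.2) c)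
      r.1

/-- The matrix `𝒞(𝓕)`. -/
def matC (A : Matrix (Fin n) (Fin n) ℝ) (B : Matrix (Fin n) (Fin m) ℝ)
    (C : Matrix (Fin p) (Fin n) ℝ) (𝓕 : Matrix (Fin N × Fin m) (Fin N × Fin p) ℝ) :
    Matrix ((Fin N × Fin m) ⊕ (Fin (N - 1) × Fin n)) ((Fin N × Fin n) ⊕ (Fin N × Fin m)) ℝ :=
  Matrix.fromBlocks
    (𝓕 * ((1 : Matrix (Fin N) (Fin N) ℝ) ⊗ₖ C))
    (-((1 : Matrix (Fin N) (Fin N) ℝ) ⊗ₖ (1 : Matrix (Fin m) (Fin m) ℝ)))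
    (matL (N - 1) N ⊗ₖ A - matR (N - 1) N ⊗ₖ (1 : Matrix (Fin n) (Fin n) ℝ))
    (matL (N - 1) N ⊗ₖ B)

/-- The matrix `ℋ(𝓕)`. -/
def matH (A : Matrix (Fin n) (Fin n) ℝ) (B : Matrix (Fin n) (Fin m) ℝ)
    (𝓕 : Matrix (Fin N × Fin m) (Fin N × Fin n) ℝ) :
    Matrix ((Fin N × Fin m) ⊕ (Fin (N - 1) × Fin n)) ((Fin N × Fin n) ⊕ (Fin N × Fin m)) ℝ :=
  Matrix.fromBlocks
    𝓕
    (-((1 : Matrix (Fin N) (Fin N) ℝ) ⊗ₖ (1 : Matrix (Fin m) (Fin m) ℝ)))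
    (matL (N - 1) N ⊗ₖ A - matR (N - 1) N ⊗ₖ (1 : Matrix (Fin n) (Fin n) ℝ))
    (matL (N - 1) N ⊗ₖ B)

/-- The block upper triangular matrix with blocks `G i j`, `i ≤ j`. -/
def blockUpper {a b : ℕ} (G : Fin N → Fin N → Matrix (Fin a) (Fin b) ℝ) :
    Matrix (Fin N × Fin a) (Fin N × Fin b) ℝ :=
  Matrix.of fun r c => if r.1 ≤ c.1 then G r.1 c.1 r.2 c.2 else 0

/-- `(P, 𝒥, 𝒢)` solves Ebihara's LMI (with `𝒢`, `𝒥` block upper triangular). -/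
def EbiharaLMI (A : Matrix (Fin n) (Fin n) ℝ) (B : Matrix (Fin n) (Fin m) ℝ)
    (P : Matrix (Fin n) (Fin n) ℝ) (J : Fin N → Fin N → Matrix (Fin m) (Fin n) ℝ)
    (G : Fin N → Fin N → Matrix (Fin n) (Fin n) ℝ) : Prop :=
  P.IsSymm ∧
  NegDef (matX N N P 1 + He (
    ((matL N (N + 1)).transpose ⊗ₖ A) * blockUpper G *
        (matR N (N + 1) ⊗ₖ (1 : Matrix (Fin n) (Fin n) ℝ))
      + ((matL N (N + 1)).transpose ⊗ₖ B) * blockUpper J *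
        (matR N (N + 1) ⊗ₖ (1 : Matrix (Fin n) (Fin n) ℝ))
      - ((matR N (N + 1)).transpose ⊗ₖ (1 : Matrix (Fin n) (Fin n) ℝ)) * blockUpper G *
        (matR N (N + 1) ⊗ₖ (1 : Matrix (Fin n) (Fin n) ℝ))))

/-- `𝓕_SF^{(N,↓)} = (T_N ⊗ I_m) 𝒥 𝒢⁻¹ (T_N ⊗ I_n)`. -/
noncomputable def sfGain (J : Fin N → Fin N → Matrix (Fin m) (Fin n) ℝ)
    (G : Fin N → Fin N → Matrix (Fin n) (Fin n) ℝ) :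
    Matrix (Fin N × Fin m) (Fin N × Fin n) ℝ :=
  (matT N ⊗ₖ (1 : Matrix (Fin m) (Fin m) ℝ)) * blockUpper J * (blockUpper G)⁻¹ *
    (matT N ⊗ₖ (1 : Matrix (Fin n) (Fin n) ℝ))

/-- The matrix inequalities `P ≻ 0` and
`Π_Nᵀ 𝒳_N(P,1) Π_N + He{ℋ(𝓕_SF)ᵀ 𝒱 𝒞(𝓕_SOF)} ≺ 0`. -/
def SynthesisBMI (A : Matrix (Fin n) (Fin n) ℝ) (B : Matrix (Fin n) (Fin m) ℝ)
    (C : Matrix (Fin p) (Fin n) ℝ) (𝓕SF : Matrix (Fin N × Fin m) (Fin N × Fin n) ℝ)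
    (P : Matrix (Fin n) (Fin n) ℝ)
    (𝒱 : Matrix ((Fin N × Fin m) ⊕ (Fin (N - 1) × Fin n))
      ((Fin N × Fin m) ⊕ (Fin (N - 1) × Fin n)) ℝ)
    (𝓕SOF : Matrix (Fin N × Fin m) (Fin N × Fin p) ℝ) : Prop :=
  P.PosDef ∧
  NegDef ((matPi N A B).transpose * matX N N P 1 * matPi N A B +
    He ((matH A B 𝓕SF).transpose * 𝒱 * matC A B C 𝓕SOF))

end PeriodicSOF

open PeriodicSOF

/-!
The kernel of `𝒞(𝓕)` consists of the closed-loop trajectories over one period, and on it the form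
`Πᵀ 𝒳(P, 1) Π` is the Lyapunov difference `x(N)ᵀ P x(N) - x(0)ᵀ P x(0)`. Hence the form is negative
on `ker 𝒞(𝓕) ∖ {0}` exactly if `𝒜_LTIᵀ P 𝒜_LTI - P ≺ 0`. Since `ℋ(𝓚)` is `𝒞(𝓚)` for `C = I`, the
projection lemma eliminates `𝒱`: for fixed `𝓕` and `P ≻ 0` the inequality is solvable in `𝒱` iff `P`
is a Lyapunov matrix of both feedbacks `𝓚` and `𝓕`, and assumption (b) provides such a pair. A
quadratic Lyapunov function makes the LTI system asymptotically stable, and so is then the periodic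
system, because the states within a period are bounded by the state at its start.
-/

namespace PeriodicSOF

open Matrix Filter

/-! ### Functions homogeneous of degree two -/

/-- Continuous functions that are homogeneous of degree two. They stand for both quadratic forms and
squared norms, which are compared with each other by compactness of the unit sphere. -/
structure IsContQuadratic {E : Type*} [NormedAddCommGroup E] [NormedSpace ℝ E] (f : E → ℝ) :
    Prop where
  continuous : Continuous f
  map_smul : ∀ (c : ℝ) z, f (c • z) = c ^ 2 * f z

namespace IsContQuadratic

variable {E : Type*} [NormedAddCommGroup E] [NormedSpace ℝ E] {f g : E → ℝ}

theorem map_zero (hf : IsContQuadratic f) : f 0 = 0 := by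
  simpa using hf.map_smul 0 0

theorem sub (hf : IsContQuadratic f) (hg : IsContQuadratic g) :
    IsContQuadratic fun z => f z - g z where
  continuous := hf.continuous.sub hg.continuous
  map_smul c z := by rw [hf.map_smul, hg.map_smul, mul_sub]

theorem norm_sq : IsContQuadratic fun z : E => ‖z‖ ^ 2 where
  continuous := by fun_prop
  map_smul c z := by rw [norm_smul, mul_pow, Real.norm_eq_abs, sq_abs]

theorem exists_lt_mul [ProperSpace E] (hf : IsContQuadratic f) (hg : IsContQuadratic g)
    (hf0 : ∀ z, 0 ≤ f z) (hfg : ∀ z, z ≠ 0 → f z = 0 → g z < 0) :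
    ∃ ρ : ℝ, 1 ≤ ρ ∧ ∀ z, z ≠ 0 → g z < ρ * f z := by
  let U (k : ℕ) : Set E := {z | g z < (k + 1 : ℝ) * f z}
  have hU_open (k : ℕ) : IsOpen (U k) :=
    isOpen_lt hg.continuous (continuous_const.mul hf.continuous)
  have hU_mono : Monotone U := fun a b hab z (hz : g z < _) =>
    hz.trans_le <| by gcongr; exact hf0 z
  have hU_cover : Metric.sphere (0 : E) 1 ⊆ ⋃ k, U k := fun z hz => by
    have hz0 : z ≠ 0 := Metric.ne_of_mem_sphere hz one_ne_zero
    rw [Set.mem_iUnion]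
    rcases (hf0 z).eq_or_lt with h | h
    · exact ⟨0, by simpa [U, ← h] using hfg z hz0 h.symm⟩
    · obtain ⟨k, hk⟩ := exists_nat_gt (g z / f z)
      exact ⟨k, (div_lt_iff₀ h).1 (hk.trans (lt_add_one _))⟩
  obtain ⟨k, hk⟩ := (isCompact_sphere (0 : E) 1).elim_directed_cover U hU_open hU_cover
    hU_mono.directed_le
  refine ⟨k + 1, by simp, fun z hz => ?_⟩
  have hunit : ‖z‖⁻¹ • z ∈ U k := hk (by simp [norm_smul, hz])
  have hscaled : ‖z‖⁻¹ ^ 2 * g z < (k + 1) * (‖z‖⁻¹ ^ 2 * f z) := by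
    rw [← hf.map_smul, ← hg.map_smul]
    exact hunit
  rw [mul_left_comm] at hscaled
  exact lt_of_mul_lt_mul_left hscaled (by positivity)

theorem exists_le_mul [ProperSpace E] (hf : IsContQuadratic f) (hg : IsContQuadratic g)
    (hf0 : ∀ z, z ≠ 0 → 0 < f z) : ∃ ρ : ℝ, 1 ≤ ρ ∧ ∀ z, g z ≤ ρ * f z := by
  have hf_nonneg (z : E) : 0 ≤ f z := by
    rcases eq_or_ne z 0 with rfl | hz
    exacts [hf.map_zero.ge, (hf0 z hz).le]
  obtain ⟨ρ, hρ, h⟩ := hf.exists_lt_mul hg hf_nonneg fun z hz hfz => absurd hfz (hf0 z hz).ne'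
  refine ⟨ρ, hρ, fun z => ?_⟩
  rcases eq_or_ne z 0 with rfl | hz
  · simp [hf.map_zero, hg.map_zero]
  · exact (h z hz).le

theorem exists_le_mul_of_lt [ProperSpace E] (hf : IsContQuadratic f) (hg : IsContQuadratic g)
    (h : ∀ z, z ≠ 0 → g z < f z) : ∃ r : ℝ, 0 ≤ r ∧ r < 1 ∧ ∀ z, g z ≤ r * f z := by
  obtain ⟨ρ, hρ, hle⟩ := (hf.sub hg).exists_le_mul hf fun z hz => sub_pos.2 (h z hz)
  have hρ0 : 0 < ρ := one_pos.trans_le hρ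
  refine ⟨1 - ρ⁻¹, sub_nonneg.2 (inv_le_one_of_one_le₀ hρ), sub_lt_self _ (inv_pos.2 hρ0),
    fun z => ?_⟩
  have := (inv_mul_le_iff₀ hρ0).2 (hle z)
  linarith

end IsContQuadratic

/-! ### Quadratic forms of real matrices -/

section QuadForm

variable {ι κ μ : Type*} [Fintype κ]

theorem isSymm_conj {P : Matrix κ κ ℝ} (hP : P.IsSymm) (M : Matrix κ ι ℝ) :
    (Mᵀ * P * M).IsSymm := by
  simp [IsSymm, hP.eq, Matrix.mul_assoc]

variable [Fintype ι]

theorem isContQuadratic_quadForm (Q : Matrix ι ι ℝ) :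
    IsContQuadratic fun z : ι → ℝ => z ⬝ᵥ Q *ᵥ z where
  continuous := by simp only [dotProduct, mulVec]; fun_prop
  map_smul c z := by
    simp only [mulVec_smul, smul_dotProduct, dotProduct_smul, smul_eq_mul]
    ring

theorem quadForm_conj (P : Matrix κ κ ℝ) (M : Matrix κ ι ℝ) (x : ι → ℝ) :
    x ⬝ᵥ (Mᵀ * P * M) *ᵥ x = (M *ᵥ x) ⬝ᵥ P *ᵥ (M *ᵥ x) := by
  rw [Matrix.mul_assoc, ← mulVec_mulVec, dotProduct_transpose_mulVec, ← mulVec_mulVec,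
    dotProduct_comm]

theorem quadForm_he (M : Matrix ι ι ℝ) (x : ι → ℝ) : x ⬝ᵥ He M *ᵥ x = 2 * (x ⬝ᵥ M *ᵥ x) := by
  rw [He, add_mulVec, dotProduct_add, dotProduct_transpose_mulVec, two_mul]

theorem quadForm_add {Q : Matrix ι ι ℝ} (hQ : Q.IsSymm) (a b : ι → ℝ) :
    (a + b) ⬝ᵥ Q *ᵥ (a + b) = a ⬝ᵥ Q *ᵥ a + 2 * (a ⬝ᵥ Q *ᵥ b) + b ⬝ᵥ Q *ᵥ b := by
  have hba : b ⬝ᵥ Q *ᵥ a = a ⬝ᵥ Q *ᵥ b := by rw [← dotProduct_transpose_mulVec, hQ.eq]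
  rw [mulVec_add, add_dotProduct, dotProduct_add, dotProduct_add, hba]
  ring

theorem posDef_iff_quadForm {M : Matrix ι ι ℝ} :
    M.PosDef ↔ M.IsSymm ∧ ∀ x, x ≠ 0 → 0 < x ⬝ᵥ M *ᵥ x := by
  simp [posDef_iff_dotProduct_mulVec, IsHermitian, IsSymm, conjTranspose_eq_transpose_of_trivial]

theorem negDef_iff_quadForm {M : Matrix ι ι ℝ} :
    NegDef M ↔ M.IsSymm ∧ ∀ x, x ≠ 0 → x ⬝ᵥ M *ᵥ x < 0 := by
  simp [NegDef, posDef_iff_quadForm, IsSymm, neg_mulVec]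

/-! ### The projection lemma -/

theorem exists_posDef_smul_transpose_mul_self_sub {Q : Matrix ι ι ℝ} (hQ : Q.IsSymm)
    (H : Matrix κ ι ℝ) (hH : ∀ z, z ≠ 0 → H *ᵥ z = 0 → z ⬝ᵥ Q *ᵥ z < 0) :
    ∃ ρ : ℝ, 0 ≤ ρ ∧ (ρ • (Hᵀ * H) - Q).PosDef := by
  have hHH (z : ι → ℝ) : z ⬝ᵥ (Hᵀ * H) *ᵥ z = (H *ᵥ z) ⬝ᵥ (H *ᵥ z) := by
    rw [← mulVec_mulVec, dotProduct_transpose_mulVec]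
  have hHH_symm : (Hᵀ * H).IsSymm := by simp [IsSymm]
  obtain ⟨ρ, hρ, h⟩ := (isContQuadratic_quadForm (Hᵀ * H)).exists_lt_mul
    (isContQuadratic_quadForm Q)
    (fun z => (hHH z).symm ▸ Finset.sum_nonneg fun _ _ => mul_self_nonneg _)
    fun z hz h0 => hH z hz (dotProduct_self_eq_zero.1 (hHH z ▸ h0))
  refine ⟨ρ, zero_le_one.trans hρ, posDef_iff_quadForm.2
    ⟨(hHH_symm.smul ρ).sub hQ, fun z hz => ?_⟩⟩
  rw [sub_mulVec, dotProduct_sub, smul_mulVec, dotProduct_smul, smul_eq_mul]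
  exact sub_pos.2 (h z hz)

theorem exists_generalizedInverse_orthogonal [Fintype μ] {S : Matrix ι ι ℝ} (hS : S.PosDef)
    (C : Matrix μ ι ℝ) :
    ∃ G : Matrix ι μ ℝ, ∀ z, C *ᵥ (G *ᵥ (C *ᵥ z)) = C *ᵥ z ∧
      ∀ a, C *ᵥ a = 0 → a ⬝ᵥ S *ᵥ (G *ᵥ (C *ᵥ z)) = 0 := by
  classical
  obtain ⟨hS_symm, hS_pos⟩ := posDef_iff_quadForm.1 hS
  let β : LinearMap.BilinForm ℝ (ι → ℝ) := Matrix.toBilin' S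
  have hβ (x y : ι → ℝ) : β x y = x ⬝ᵥ S *ᵥ y := Matrix.toBilin'_apply' S x y
  have hβ_refl : β.IsRefl := fun x y h => by
    rw [hβ, ← dotProduct_transpose_mulVec, hS_symm.eq, ← hβ, h]
  let W := LinearMap.ker C.mulVecLin
  have hcompl : IsCompl W (β.orthogonal W) := by
    rw [LinearMap.BilinForm.isCompl_orthogonal_iff_disjoint hβ_refl, Submodule.disjoint_def]
    intro x hxW hx
    by_contra hx0
    exact (hS_pos x hx0).ne' (hβ x x ▸ hx x hxW)
  obtain ⟨g, hg⟩ := (C.mulVecLin ∘ₗ (β.orthogonal W).subtype).exists_leftInverse_of_injective <| by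
    rw [LinearMap.ker_comp, ← Submodule.disjoint_iff_comap_eq_bot]
    exact hcompl.disjoint.symm
  refine ⟨LinearMap.toMatrix' ((β.orthogonal W).subtype ∘ₗ g), fun z => ?_⟩
  obtain ⟨a, ha, b, hb, rfl⟩ := Submodule.sup_eq_top_iff _ _ |>.1 hcompl.sup_eq_top z
  have hCab : C *ᵥ (a + b) = C *ᵥ b := by
    rw [mulVec_add, show C *ᵥ a = 0 from ha, zero_add]
  have hgb : g (C *ᵥ b) = ⟨b, hb⟩ := LinearMap.congr_fun hg ⟨b, hb⟩
  rw [hCab, LinearMap.toMatrix'_mulVec, LinearMap.comp_apply, hgb, Submodule.subtype_apply]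
  exact ⟨rfl, fun a' ha' => hβ a' b ▸ hb a' ha'⟩

theorem quadForm_add_he [Fintype μ] (Q : Matrix ι ι ℝ) (H : Matrix κ ι ℝ) (V : Matrix κ μ ℝ)
    (C : Matrix μ ι ℝ) (z : ι → ℝ) :
    z ⬝ᵥ (Q + He (Hᵀ * V * C)) *ᵥ z = z ⬝ᵥ Q *ᵥ z + 2 * ((H *ᵥ z) ⬝ᵥ V *ᵥ (C *ᵥ z)) := by
  rw [add_mulVec, dotProduct_add, quadForm_he, Matrix.mul_assoc, ← mulVec_mulVec,
    dotProduct_transpose_mulVec, ← mulVec_mulVec, dotProduct_comm (H *ᵥ z)]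

-- Let `z = a + b` be the splitting along `ker C` that is orthogonal for `S = ρ Hᵀ H - Q ≻ 0`. With
-- `V = -ρ H G` the form takes the value `aᵀ Q a - bᵀ S b - ρ |H b|²` at `z`.
theorem exists_negDef_add_he [Fintype μ] {Q : Matrix ι ι ℝ} (hQ : Q.IsSymm)
    {H : Matrix κ ι ℝ} {C : Matrix μ ι ℝ} (hH : ∀ z, z ≠ 0 → H *ᵥ z = 0 → z ⬝ᵥ Q *ᵥ z < 0)
    (hC : ∀ z, z ≠ 0 → C *ᵥ z = 0 → z ⬝ᵥ Q *ᵥ z < 0) :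
    ∃ V : Matrix κ μ ℝ, NegDef (Q + He (Hᵀ * V * C)) := by
  obtain ⟨ρ, hρ, hS⟩ := exists_posDef_smul_transpose_mul_self_sub hQ H hH
  obtain ⟨G, hG⟩ := exists_generalizedInverse_orthogonal hS C
  refine ⟨-ρ • (H * G), negDef_iff_quadForm.2
    ⟨hQ.add (isSymm_transpose_add_self _), fun z hz => ?_⟩⟩
  obtain ⟨b, hb⟩ : ∃ b, G *ᵥ (C *ᵥ z) = b := ⟨_, rfl⟩
  obtain ⟨a, rfl⟩ : ∃ a, z = a + b := ⟨z - b, (sub_add_cancel z b).symm⟩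
  have hS_form (x y : ι → ℝ) : x ⬝ᵥ (ρ • (Hᵀ * H) - Q) *ᵥ y =
      ρ * ((H *ᵥ x) ⬝ᵥ (H *ᵥ y)) - x ⬝ᵥ Q *ᵥ y := by
    rw [sub_mulVec, dotProduct_sub, smul_mulVec, dotProduct_smul, ← mulVec_mulVec,
      dotProduct_transpose_mulVec, dotProduct_comm (H *ᵥ y), smul_eq_mul]
  obtain ⟨hCb, hS_orth⟩ := hG (a + b)
  rw [hb, mulVec_add, right_eq_add] at hCb
  have hcross : ρ * ((H *ᵥ a) ⬝ᵥ (H *ᵥ b)) = a ⬝ᵥ Q *ᵥ b := by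
    rw [← sub_eq_zero, ← hS_form, ← hb]
    exact hS_orth a hCb
  have hvalue : (a + b) ⬝ᵥ (Q + He (Hᵀ * (-ρ • (H * G)) * C)) *ᵥ (a + b) =
      a ⬝ᵥ Q *ᵥ a - b ⬝ᵥ (ρ • (Hᵀ * H) - Q) *ᵥ b - ρ * ((H *ᵥ b) ⬝ᵥ (H *ᵥ b)) := by
    rw [quadForm_add_he, quadForm_add hQ, hS_form, smul_mulVec, ← mulVec_mulVec, hb,
      mulVec_add H, dotProduct_smul, add_dotProduct, smul_eq_mul]
    linear_combination -2 * hcross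
  rw [hvalue]
  have hHb : 0 ≤ ρ * ((H *ᵥ b) ⬝ᵥ (H *ᵥ b)) :=
    mul_nonneg hρ (Finset.sum_nonneg fun _ _ => mul_self_nonneg _)
  rcases eq_or_ne b 0 with rfl | hb0
  · simpa using hC a (by simpa using hz) hCb
  · have hbS := (posDef_iff_quadForm.1 hS).2 b hb0
    have ha : a ⬝ᵥ Q *ᵥ a ≤ 0 := by
      rcases eq_or_ne a 0 with rfl | ha0
      exacts [by simp, (hC a ha0 hCb).le]
    linarith

theorem exists_negDef_add_he_iff [Fintype μ] {Q : Matrix ι ι ℝ} (hQ : Q.IsSymm)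
    (H : Matrix κ ι ℝ) (C : Matrix μ ι ℝ) :
    (∃ V : Matrix κ μ ℝ, NegDef (Q + He (Hᵀ * V * C))) ↔
      (∀ z, z ≠ 0 → H *ᵥ z = 0 → z ⬝ᵥ Q *ᵥ z < 0) ∧
        ∀ z, z ≠ 0 → C *ᵥ z = 0 → z ⬝ᵥ Q *ᵥ z < 0 := by
  refine ⟨fun ⟨V, hV⟩ => ?_, fun ⟨hH, hC⟩ => exists_negDef_add_he hQ hH hC⟩
  have hneg := (negDef_iff_quadForm.1 hV).2
  simp only [quadForm_add_he] at hneg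
  exact ⟨fun z hz h => by simpa [h] using hneg z hz, fun z hz h => by simpa [h] using hneg z hz⟩

end QuadForm

/-! ### Lyapunov stability of the equivalent LTI system -/

section Lyapunov

variable {n : ℕ} {𝒜 P : Matrix (Fin n) (Fin n) ℝ}

theorem mem_lyapunovSet_iff : P ∈ lyapunovSet 𝒜 ↔
    P.PosDef ∧ ∀ x, x ≠ 0 → (𝒜 *ᵥ x) ⬝ᵥ P *ᵥ (𝒜 *ᵥ x) < x ⬝ᵥ P *ᵥ x := by
  refine and_congr_right fun hP => ?_
  have hP_symm := (posDef_iff_quadForm.1 hP).1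
  simp only [negDef_iff_quadForm, (isSymm_conj hP_symm 𝒜).sub hP_symm, true_and, sub_mulVec,
    dotProduct_sub, quadForm_conj, sub_neg]

theorem exists_norm_sq_le_of_mem_lyapunovSet (hP : P ∈ lyapunovSet 𝒜) :
    ∃ K r : ℝ, 1 ≤ K ∧ 0 ≤ r ∧ r < 1 ∧ ∀ φ : ℕ → Fin n → ℝ, (∀ t, φ (t + 1) = 𝒜 *ᵥ φ t) →
      ∀ t, ‖φ t‖ ^ 2 ≤ K * r ^ t * ‖φ 0‖ ^ 2 := by
  obtain ⟨hP_pos, h𝒜⟩ := mem_lyapunovSet_iff.1 hP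
  have hV := isContQuadratic_quadForm P
  obtain ⟨α, hα, hα_le⟩ := hV.exists_le_mul .norm_sq (posDef_iff_quadForm.1 hP_pos).2
  obtain ⟨β, hβ, hβ_le⟩ := IsContQuadratic.norm_sq.exists_le_mul hV fun z hz => by positivity
  obtain ⟨r, hr0, hr1, hr_le⟩ := hV.exists_le_mul_of_lt
    (isContQuadratic_quadForm (𝒜ᵀ * P * 𝒜)) fun z hz => (quadForm_conj P 𝒜 z).trans_lt (h𝒜 z hz)
  refine ⟨α * β, r, one_le_mul_of_one_le_of_one_le hα hβ, hr0, hr1, fun φ hφ t => ?_⟩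
  have hdecay : φ t ⬝ᵥ P *ᵥ φ t ≤ r ^ t * (φ 0 ⬝ᵥ P *ᵥ φ 0) := by
    induction t with
    | zero => simp
    | succ t ih =>
      rw [hφ, ← quadForm_conj]
      exact ((hr_le (φ t)).trans (mul_le_mul_of_nonneg_left ih hr0)).trans_eq (by ring)
  calc ‖φ t‖ ^ 2 ≤ α * (φ t ⬝ᵥ P *ᵥ φ t) := hα_le _
    _ ≤ α * (r ^ t * (β * ‖φ 0‖ ^ 2)) := by
      gcongr
      exact hdecay.trans (by gcongr; exact hβ_le _)
    _ = α * β * r ^ t * ‖φ 0‖ ^ 2 := by ring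

theorem ltiAsympStable_of_mem_lyapunovSet (hP : P ∈ lyapunovSet 𝒜) : LTIAsympStable 𝒜 := by
  obtain ⟨K, r, hK, hr0, hr1, hbound⟩ := exists_norm_sq_le_of_mem_lyapunovSet hP
  have hK0 : 0 < K := one_pos.trans_le hK
  refine ⟨fun ε hε => ⟨ε / K, by positivity, fun φ hφ h0 t => ?_⟩, fun φ hφ => ?_⟩
  · refine lt_of_pow_lt_pow_left₀ 2 hε.le ?_
    calc ‖φ t‖ ^ 2 ≤ K * r ^ t * ‖φ 0‖ ^ 2 := hbound φ hφ t
      _ ≤ K * 1 * ‖φ 0‖ ^ 2 := by gcongr; exact pow_le_one₀ hr0 hr1.le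
      _ ≤ K * K * ‖φ 0‖ ^ 2 := by gcongr
      _ = (K * ‖φ 0‖) ^ 2 := by ring
      _ < ε ^ 2 := by gcongr; rwa [lt_div_iff₀' hK0] at h0
  · have hgeom : Tendsto (fun t => K * r ^ t * ‖φ 0‖ ^ 2) atTop (𝓝 0) := by
      simpa using ((tendsto_pow_atTop_nhds_zero_of_lt_one hr0 hr1).const_mul K).mul_const _
    have hsq : Tendsto (fun t => ‖φ t‖ ^ 2) atTop (𝓝 0) :=
      squeeze_zero (fun _ => sq_nonneg _) (hbound φ hφ) hgeom
    simpa [tendsto_zero_iff_norm_tendsto_zero] using hsq.sqrt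

end Lyapunov

/-! ### Block vectors -/

section Stack

variable {α β : Type*} {N : ℕ}

/-- The block vector with the blocks `x 0, …, x (N - 1)`. Signals are indexed by `ℕ`, so that shifts
and windows of different lengths are block vectors of the same kind of object. -/
def stack (N : ℕ) (x : ℕ → α → ℝ) : Fin N × α → ℝ := fun q => x q.1 q.2

theorem stack_inj {x y : ℕ → α → ℝ} : stack N x = stack N y ↔ ∀ k < N, x k = y k := by
  simp only [funext_iff, Prod.forall, Fin.forall_iff, stack]

theorem exists_stack_eq (z : Fin N × α → ℝ) : ∃ x, stack N x = z :=
  ⟨fun k a => if h : k < N then z (⟨k, h⟩, a) else 0, by ext; simp [stack]⟩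

theorem stack_add (x y : ℕ → α → ℝ) : stack N (x + y) = stack N x + stack N y := rfl

theorem isSymm_kronecker {ι : Type*} {M : Matrix ι ι ℝ} {P : Matrix α α ℝ} (hM : M.IsSymm)
    (hP : P.IsSymm) : (M ⊗ₖ P).IsSymm := by
  rw [IsSymm, ← kroneckerMap_transpose, hM.eq, hP.eq]

variable [Fintype α]

theorem kronecker_mulVec_stack {ι : Type*} (M : Matrix ι (Fin N) ℝ) (A : Matrix β α ℝ)
    (x : ℕ → α → ℝ) (q : ι × β) :
    ((M ⊗ₖ A) *ᵥ stack N x) q = ∑ j, M q.1 j * (A *ᵥ x j) q.2 := by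
  simp only [mulVec, dotProduct, Fintype.sum_prod_type, kroneckerMap_apply, stack, Finset.mul_sum,
    mul_assoc]

theorem one_kronecker_mulVec_stack (A : Matrix β α ℝ) (x : ℕ → α → ℝ) :
    ((1 : Matrix (Fin N) (Fin N) ℝ) ⊗ₖ A) *ᵥ stack N x = stack N fun k => A *ᵥ x k := by
  ext q
  simp [kronecker_mulVec_stack, one_apply, stack]

theorem matL_kronecker_mulVec_stack {k l : ℕ} (hkl : k ≤ l) (A : Matrix β α ℝ) (x : ℕ → α → ℝ) :
    (matL k l ⊗ₖ A) *ᵥ stack l x = stack k fun i => A *ᵥ x i := by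
  ext ⟨i, b⟩
  rw [kronecker_mulVec_stack, Fintype.sum_eq_single (i.castLE hkl)]
  · simp [matL, stack]
  · intro j hj
    simp [matL, show (j : ℕ) ≠ i from fun h => hj (Fin.ext h)]

-- The truncated subtraction covers the case `k = l = 0`.
theorem matR_kronecker_mulVec_stack {k l : ℕ} (hkl : k ≤ l - 1) (A : Matrix β α ℝ)
    (x : ℕ → α → ℝ) : (matR k l ⊗ₖ A) *ᵥ stack l x = stack k fun i => A *ᵥ x (i + 1) := by
  ext ⟨i, b⟩
  rw [kronecker_mulVec_stack, Fintype.sum_eq_single ⟨i + 1, by lia⟩]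
  · simp [matR, stack]
  · intro j hj
    simp [matR, show (j : ℕ) ≠ i + 1 from fun h => hj (Fin.ext h)]

theorem quadForm_kronecker_stack (M : Matrix (Fin N) (Fin N) ℝ) (P : Matrix α α ℝ)
    (x : ℕ → α → ℝ) :
    stack N x ⬝ᵥ (M ⊗ₖ P) *ᵥ stack N x = ∑ i : Fin N, ∑ j : Fin N, M i j * (x i ⬝ᵥ P *ᵥ x j) := by
  rw [dotProduct, Fintype.sum_prod_type]
  refine Finset.sum_congr rfl fun i _ => ?_
  simp only [kronecker_mulVec_stack, stack, Finset.mul_sum, dotProduct]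
  rw [Finset.sum_comm]
  simp only [mul_left_comm]

end Stack

section MatX

variable {n N : ℕ} {P : Matrix (Fin n) (Fin n) ℝ}

theorem isSymm_matX (hP : P.IsSymm) (δ : ℕ) (γ : ℝ) : (matX N δ P γ).IsSymm :=
  isSymm_kronecker (by simp [IsSymm, transpose_vecMulVec]) hP

theorem quadForm_matX_stack {δ : ℕ} (hδ : δ ≤ N) (γ : ℝ) (x : ℕ → Fin n → ℝ) :
    stack (N + 1) x ⬝ᵥ matX N δ P γ *ᵥ stack (N + 1) x =
      x δ ⬝ᵥ P *ᵥ x δ - γ * (x 0 ⬝ᵥ P *ᵥ x 0) := by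
  have hunit {k : ℕ} (hk : k ≤ N) :
      unitVec (N + 1) (k + 1) = Pi.single (⟨k, by lia⟩ : Fin (N + 1)) 1 := by
    ext i
    simp [unitVec, Pi.single_apply, Fin.ext_iff]
  have hunit_zero : unitVec (N + 1) 1 = Pi.single 0 1 := hunit N.zero_le
  rw [matX, quadForm_kronecker_stack, hunit_zero, hunit hδ, ← single_eq_single_vecMulVec_single,
    ← single_eq_single_vecMulVec_single]
  simp [single, add_mul, Finset.sum_add_distrib, ite_and, sub_eq_neg_add]

end MatX

/-! ### Closed-loop trajectories over one period -/

/-- Block lower triangular matrices, with rectangular blocks. -/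
def IsBlockLower {N : ℕ} {α β : Type*} (M : Matrix (Fin N × α) (Fin N × β) ℝ) : Prop :=
  ∀ r c, r.1 < c.1 → M r c = 0

section ClosedLoop

variable {n m p N : ℕ}

/-- `x 0, …, x N` and `u 0, …, u (N - 1)` are the states and the inputs of the closed loop of
`(A, B, C)` with the gain matrix `𝓕` over one period. -/
def IsClosedLoop (A : Matrix (Fin n) (Fin n) ℝ) (B : Matrix (Fin n) (Fin m) ℝ)
    (C : Matrix (Fin p) (Fin n) ℝ) (𝓕 : Matrix (Fin N × Fin m) (Fin N × Fin p) ℝ)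
    (x : ℕ → Fin n → ℝ) (u : ℕ → Fin m → ℝ) : Prop :=
  (∀ k < N, x (k + 1) = A *ᵥ x k + B *ᵥ u k) ∧ stack N u = 𝓕 *ᵥ stack N fun k => C *ᵥ x k

variable {A : Matrix (Fin n) (Fin n) ℝ} {B : Matrix (Fin n) (Fin m) ℝ}
  {C : Matrix (Fin p) (Fin n) ℝ} {𝓕 : Matrix (Fin N × Fin m) (Fin N × Fin p) ℝ}
  {x x' : ℕ → Fin n → ℝ} {u u' : ℕ → Fin m → ℝ}

theorem IsClosedLoop.congr (h : IsClosedLoop A B C 𝓕 x u) (hx : ∀ k ≤ N, x' k = x k)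
    (hu : ∀ k < N, u' k = u k) : IsClosedLoop A B C 𝓕 x' u' := by
  have hy : stack N (fun k => C *ᵥ x' k) = stack N fun k => C *ᵥ x k :=
    stack_inj.2 fun k hk => by rw [hx k hk.le]
  refine ⟨fun k hk => ?_, ?_⟩
  · rw [hx _ hk, hx k hk.le, hu k hk, h.1 k hk]
  · rw [stack_inj.2 hu, hy, h.2]

theorem IsClosedLoop.augMatrix_mulVec_stack (h : IsClosedLoop A B C 𝓕 x u) :
    augMatrix A B C 𝓕 *ᵥ stack N x = stack N fun k => x (k + 1) := by
  rw [augMatrix, add_mulVec, ← mulVec_mulVec, ← mulVec_mulVec, one_kronecker_mulVec_stack,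
    one_kronecker_mulVec_stack, ← h.2, one_kronecker_mulVec_stack, ← stack_add]
  exact stack_inj.2 fun k hk => (h.1 k hk).symm

section Leading

variable {δ : ℕ} {𝓕 : Matrix (Fin (δ + 1) × Fin m) (Fin (δ + 1) × Fin p) ℝ}

theorem isBlockLower_leading (h𝓕 : IsBlockLower 𝓕) : IsBlockLower (leading 𝓕) :=
  fun r c hrc => h𝓕 _ _ (by simpa using hrc)

theorem leading_mulVec_stack (h𝓕 : IsBlockLower 𝓕) (y : ℕ → Fin p → ℝ)
    (k : Fin δ) (i : Fin m) :
    (leading 𝓕 *ᵥ stack δ y) (k, i) = (𝓕 *ᵥ stack (δ + 1) y) (k.castSucc, i) := by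
  have hlast (j : Fin p) : 𝓕 (k.castSucc, i) (Fin.last δ, j) = 0 := h𝓕 _ _ k.castSucc_lt_last
  simp [mulVec, dotProduct, Fintype.sum_prod_type, Fin.sum_univ_castSucc, hlast, stack,
    leading]

theorem isClosedLoop_succ_iff (h𝓕 : IsBlockLower 𝓕) :
    IsClosedLoop A B C 𝓕 x u ↔ IsClosedLoop A B C (leading 𝓕) x u ∧
      x (δ + 1) = A *ᵥ x δ + B *ᵥ u δ ∧
      u δ = fun i => (𝓕 *ᵥ stack (δ + 1) fun k => C *ᵥ x k) (Fin.last δ, i) := by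
  simp only [IsClosedLoop, Nat.forall_lt_succ_right, funext_iff, Prod.forall, Fin.forall_fin_succ',
    leading_mulVec_stack h𝓕]
  simp only [stack, Fin.val_castSucc, Fin.val_last]
  tauto

end Leading

theorem exists_isClosedLoop (A : Matrix (Fin n) (Fin n) ℝ) (B : Matrix (Fin n) (Fin m) ℝ)
    (C : Matrix (Fin p) (Fin n) ℝ) (h𝓕 : IsBlockLower 𝓕) (x₀ : Fin n → ℝ) :
    ∃ x u, IsClosedLoop A B C 𝓕 x u ∧ x 0 = x₀ := by
  induction N with
  | zero => exact ⟨fun _ => x₀, 0, ⟨by simp, Subsingleton.elim _ _⟩, rfl⟩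
  | succ δ ih =>
    obtain ⟨x, u, h, h0⟩ := ih (isBlockLower_leading h𝓕)
    let uδ : Fin m → ℝ := fun i => (𝓕 *ᵥ stack (δ + 1) fun k => C *ᵥ x k) (Fin.last δ, i)
    let x' := Function.update x (δ + 1) (A *ᵥ x δ + B *ᵥ uδ)
    have hx' {k : ℕ} (hk : k ≤ δ) : x' k = x k := Function.update_of_ne (by lia) ..
    have hy : stack (δ + 1) (fun k => C *ᵥ x' k) = stack (δ + 1) fun k => C *ᵥ x k :=
      stack_inj.2 fun k hk => by rw [hx' (Nat.le_of_lt_succ hk)]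
    refine ⟨x', Function.update u δ uδ, (isClosedLoop_succ_iff h𝓕).2 ⟨?_, ?_, ?_⟩, ?_⟩
    · exact h.congr (fun k => hx') fun k hk => Function.update_of_ne hk.ne ..
    · simp [x']
    · rw [hy, Function.update_self]
    · rw [hx' δ.zero_le, h0]

theorem IsClosedLoop.stateColumn_mulVec (h𝓕 : IsBlockLower 𝓕) (h : IsClosedLoop A B C 𝓕 x u) :
    stateColumn A B C N 𝓕 *ᵥ x 0 = stack (N + 1) x := by
  induction N with
  | zero =>
    ext ⟨k, i⟩
    obtain rfl : k = 0 := Fin.fin_one_eq_zero k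
    exact congrFun (one_mulVec (x 0)) i
  | succ δ ih =>
    have hδ := ih (isBlockLower_leading h𝓕) ((isClosedLoop_succ_iff h𝓕).1 h).1
    ext ⟨k, i⟩
    cases k using Fin.lastCases with
    | cast k =>
      calc _ = (stateColumn A B C δ (leading 𝓕) *ᵥ x 0) (k, i) := by simp [stateColumn, mulVec]
        _ = x k i := congrFun hδ (k, i)
    | last =>
      calc _ = ((augMatrix A B C 𝓕 * stateColumn A B C δ (leading 𝓕)) *ᵥ x 0) (Fin.last δ, i) := by
            simp [stateColumn, mulVec]
        _ = (augMatrix A B C 𝓕 *ᵥ stack (δ + 1) x) (Fin.last δ, i) := by rw [← mulVec_mulVec, hδ]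
        _ = x (δ + 1) i := congrFun h.augMatrix_mulVec_stack (Fin.last δ, i)

theorem IsClosedLoop.ltiMatrix_mulVec (h𝓕 : IsBlockLower 𝓕) (h : IsClosedLoop A B C 𝓕 x u) :
    ltiMatrix A B C 𝓕 *ᵥ x 0 = x N := by
  ext i
  exact (congrFun (h.stateColumn_mulVec h𝓕) (Fin.last N, i)).trans (by simp [stack])

theorem IsClosedLoop.stack_eq_zero (h𝓕 : IsBlockLower 𝓕) (h : IsClosedLoop A B C 𝓕 x u)
    (h0 : x 0 = 0) : stack N x = 0 ∧ stack N u = 0 := by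
  have hx : stack (N + 1) x = stack (N + 1) 0 := by
    rw [← h.stateColumn_mulVec h𝓕, h0, mulVec_zero]
    rfl
  have hx_zero (k : ℕ) (hk : k < N) : x k = 0 := stack_inj.1 hx k (by lia)
  have hy : stack N (fun k => C *ᵥ x k) = stack N 0 :=
    stack_inj.2 fun k hk => by rw [hx_zero k hk, mulVec_zero, Pi.zero_apply]
  exact ⟨stack_inj.2 hx_zero, by rw [h.2, hy]; exact mulVec_zero _⟩

theorem matC_mulVec_stack_eq_zero_iff :
    matC A B C 𝓕 *ᵥ Sum.elim (stack N x) (stack N u) = 0 ↔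
      (∀ k < N - 1, x (k + 1) = A *ᵥ x k + B *ᵥ u k) ∧
        stack N u = 𝓕 *ᵥ stack N fun k => C *ᵥ x k := by
  have hmatC : matC A B C 𝓕 *ᵥ Sum.elim (stack N x) (stack N u) = Sum.elim
      ((𝓕 *ᵥ stack N fun k => C *ᵥ x k) - stack N u)
      (stack (N - 1) fun k => A *ᵥ x k - x (k + 1) + B *ᵥ u k) := by
    simp only [matC, fromBlocks_mulVec, Sum.elim_comp_inl, Sum.elim_comp_inr, ← mulVec_mulVec,
      one_kronecker_mulVec_stack, neg_mulVec, sub_mulVec, one_mulVec, ← sub_eq_add_neg,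
      matL_kronecker_mulVec_stack (N.sub_le 1), matR_kronecker_mulVec_stack le_rfl]
    rfl
  have hstate (k : ℕ) : A *ᵥ x k - x (k + 1) + B *ᵥ u k = 0 ↔ x (k + 1) = A *ᵥ x k + B *ᵥ u k := by
    rw [sub_add_eq_add_sub, sub_eq_zero, eq_comm]
  rw [hmatC, ← Sum.elim_zero_zero, Sum.elim_eq_iff, sub_eq_zero, eq_comm, and_comm,
    show (0 : Fin (N - 1) × Fin n → ℝ) = stack (N - 1) 0 from rfl, stack_inj]
  simp only [Pi.zero_apply, hstate]

theorem matC_mulVec_eq_zero_iff {z : (Fin N × Fin n) ⊕ (Fin N × Fin m) → ℝ} :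
    matC A B C 𝓕 *ᵥ z = 0 ↔
      ∃ x u, IsClosedLoop A B C 𝓕 x u ∧ z = Sum.elim (stack N x) (stack N u) := by
  constructor
  · intro hz
    obtain ⟨x, hx⟩ := exists_stack_eq (z ∘ Sum.inl)
    obtain ⟨u, hu⟩ := exists_stack_eq (z ∘ Sum.inr)
    have hxu : Sum.elim (stack N x) (stack N u) = z := by rw [hx, hu, Sum.elim_comp_inl_inr]
    obtain ⟨hstate, hinput⟩ := matC_mulVec_stack_eq_zero_iff.1 (hxu ▸ hz)
    -- `z` does not determine the state at time `N`.
    let x' := Function.update x N (A *ᵥ x (N - 1) + B *ᵥ u (N - 1))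
    have hx' {k : ℕ} (hk : k < N) : x' k = x k := Function.update_of_ne hk.ne ..
    have hstack : stack N x' = stack N x := stack_inj.2 fun k => hx'
    refine ⟨x', u, ⟨fun k hk => ?_, ?_⟩, by rw [hstack, hxu]⟩
    · rw [hx' hk]
      rcases Nat.lt_or_ge (k + 1) N with hk' | hk'
      · rw [hx' hk', hstate k (by lia)]
      · obtain rfl : N = k + 1 := by lia
        exact Function.update_self ..
    · rw [hinput]
      exact congrArg _ (stack_inj.2 fun k hk => by rw [hx' hk])
  · rintro ⟨x, u, h, rfl⟩
    exact matC_mulVec_stack_eq_zero_iff.2 ⟨fun k hk => h.1 k (by lia), h.2⟩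

theorem matH_eq_matC (A : Matrix (Fin n) (Fin n) ℝ) (B : Matrix (Fin n) (Fin m) ℝ)
    (𝓕 : Matrix (Fin N × Fin m) (Fin N × Fin n) ℝ) : matH A B 𝓕 = matC A B 1 𝓕 := by
  rw [matH, matC, one_kronecker_one, one_kronecker_one, Matrix.mul_one]

/-! ### The synthesis inequalities and common Lyapunov matrices -/

theorem IsClosedLoop.matPi_mulVec (hN : 1 ≤ N) (h : IsClosedLoop A B C 𝓕 x u) :
    matPi N A B *ᵥ Sum.elim (stack N x) (stack N u) = stack (N + 1) x := by
  ext ⟨k, i⟩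
  cases k using Fin.cases with
  | zero =>
    have hfirst (j : Fin N) : unitVec N 1 j = if j = ⟨0, hN⟩ then 1 else 0 := by
      simp [unitVec, Fin.ext_iff]
    simp [matPi, mulVec, dotProduct, Fintype.sum_prod_type, hfirst, one_apply, stack]
  | succ k =>
    calc _ = (((1 : Matrix (Fin N) (Fin N) ℝ) ⊗ₖ A) *ᵥ stack N x +
            ((1 : Matrix (Fin N) (Fin N) ℝ) ⊗ₖ B) *ᵥ stack N u) (k, i) := by
          simp [matPi, mulVec, dotProduct]
      _ = (A *ᵥ x k + B *ᵥ u k) i := by simp only [one_kronecker_mulVec_stack]; rfl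
      _ = x (k + 1) i := by rw [h.1 k k.2]

theorem IsClosedLoop.quadForm_matPi (hN : 1 ≤ N) (h : IsClosedLoop A B C 𝓕 x u)
    (P : Matrix (Fin n) (Fin n) ℝ) :
    Sum.elim (stack N x) (stack N u) ⬝ᵥ
        ((matPi N A B)ᵀ * matX N N P 1 * matPi N A B) *ᵥ Sum.elim (stack N x) (stack N u) =
      x N ⬝ᵥ P *ᵥ x N - x 0 ⬝ᵥ P *ᵥ x 0 := by
  rw [quadForm_conj, h.matPi_mulVec hN, quadForm_matX_stack le_rfl, one_mul]

theorem forall_matC_ker_iff (hN : 1 ≤ N) (h𝓕 : IsBlockLower 𝓕) (P : Matrix (Fin n) (Fin n) ℝ) :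
    (∀ z, z ≠ 0 → matC A B C 𝓕 *ᵥ z = 0 →
        z ⬝ᵥ ((matPi N A B)ᵀ * matX N N P 1 * matPi N A B) *ᵥ z < 0) ↔
      ∀ x, x ≠ 0 → (ltiMatrix A B C 𝓕 *ᵥ x) ⬝ᵥ P *ᵥ (ltiMatrix A B C 𝓕 *ᵥ x) < x ⬝ᵥ P *ᵥ x := by
  constructor
  · intro hker x₀ hx₀
    obtain ⟨x, u, h, rfl⟩ := exists_isClosedLoop A B C h𝓕 x₀
    have hz : Sum.elim (stack N x) (stack N u) ≠ 0 := fun hz =>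
      hx₀ (funext fun i => congrFun hz (Sum.inl (⟨0, hN⟩, i)))
    have := hker _ hz (matC_mulVec_eq_zero_iff.2 ⟨x, u, h, rfl⟩)
    rw [h.quadForm_matPi hN, sub_neg] at this
    rwa [h.ltiMatrix_mulVec h𝓕]
  · intro hdecrease z hz hker
    obtain ⟨x, u, h, rfl⟩ := matC_mulVec_eq_zero_iff.1 hker
    have hx₀ : x 0 ≠ 0 := fun h0 => hz <| by
      obtain ⟨hx, hu⟩ := h.stack_eq_zero h𝓕 h0
      rw [hx, hu, Sum.elim_zero_zero]
    rw [h.quadForm_matPi hN, sub_neg, ← h.ltiMatrix_mulVec h𝓕]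
    exact hdecrease _ hx₀

theorem exists_synthesisBMI_iff (hN : 1 ≤ N) (h𝓕 : IsBlockLower 𝓕)
    {𝓚 : Matrix (Fin N × Fin m) (Fin N × Fin n) ℝ} (h𝓚 : IsBlockLower 𝓚)
    {P : Matrix (Fin n) (Fin n) ℝ} :
    (∃ V, SynthesisBMI A B C 𝓚 P V 𝓕) ↔
      P ∈ lyapunovSet (ltiMatrix A B 1 𝓚) ∩ lyapunovSet (ltiMatrix A B C 𝓕) := by
  simp only [SynthesisBMI, exists_and_left, Set.mem_inter_iff, mem_lyapunovSet_iff,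
    ← and_and_left, matH_eq_matC]
  refine and_congr_right fun hP => ?_
  rw [exists_negDef_add_he_iff (isSymm_conj (isSymm_matX (posDef_iff_quadForm.1 hP).1 N 1) _),
    forall_matC_ker_iff hN h𝓚, forall_matC_ker_iff hN h𝓕]

end ClosedLoop

/-! ### Block triangular gain matrices -/

/-- Block upper triangular matrices, with rectangular blocks. -/
def IsBlockUpper {N : ℕ} {α β : Type*} (M : Matrix (Fin N × α) (Fin N × β) ℝ) : Prop :=
  ∀ r c, c.1 < r.1 → M r c = 0

section BlockTriangular

variable {N : ℕ} {α β γ : Type*}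

theorem isBlockUpper_blockUpper {a b : ℕ} (G : Fin N → Fin N → Matrix (Fin a) (Fin b) ℝ) :
    IsBlockUpper (blockUpper G) :=
  fun _ _ hcr => if_neg hcr.not_ge

theorem IsBlockUpper.mul [Fintype β] {M : Matrix (Fin N × α) (Fin N × β) ℝ}
    {M' : Matrix (Fin N × β) (Fin N × γ) ℝ} (hM : IsBlockUpper M) (hM' : IsBlockUpper M') :
    IsBlockUpper (M * M') := fun r c hcr => by
  rw [mul_apply]
  refine Finset.sum_eq_zero fun q _ => ?_
  rcases lt_or_ge q.1 r.1 with hq | hq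
  · rw [hM r q hq, zero_mul]
  · rw [hM' q c (hcr.trans_le hq), mul_zero]

theorem IsBlockUpper.inv [Fintype α] [DecidableEq α] {M : Matrix (Fin N × α) (Fin N × α) ℝ}
    (hM : IsBlockUpper M) : IsBlockUpper M⁻¹ := by
  by_cases hdet : IsUnit M.det
  · have := M.invertibleOfIsUnitDet hdet
    exact blockTriangular_inv_of_blockTriangular (b := Prod.fst) fun r c hcr => hM r c hcr
  · simp [IsBlockUpper, nonsing_inv_apply_not_isUnit M hdet]

theorem IsBlockUpper.isBlockLower_matT_mul_mul_matT [Fintype α] [Fintype β]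
    [DecidableEq α] [DecidableEq β] {M : Matrix (Fin N × α) (Fin N × β) ℝ} (hM : IsBlockUpper M) :
    IsBlockLower ((matT N ⊗ₖ (1 : Matrix α α ℝ)) * M * (matT N ⊗ₖ (1 : Matrix β β ℝ))) := by
  have hmatT (i j : Fin N) : matT N i j = if i = j.rev then 1 else 0 := by
    simp only [matT, of_apply, Fin.ext_iff, Fin.val_rev]
    congr 1
    grind
  have hmatT' (i j : Fin N) : matT N i j = if i.rev = j then 1 else 0 := by
    simp only [hmatT, Fin.rev_eq_iff]
  rintro ⟨r, a⟩ ⟨c, b⟩ hrc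
  calc _ = ((matT N ⊗ₖ (1 : Matrix α α ℝ)) * M) (r, a) (c.rev, b) := by
        rw [mul_apply]
        simp [Fintype.sum_prod_type, hmatT, one_apply]
    _ = M (r.rev, a) (c.rev, b) := by
        rw [mul_apply]
        simp [Fintype.sum_prod_type, hmatT', one_apply]
    _ = 0 := hM _ _ (Fin.rev_lt_rev.2 hrc)

theorem isBlockLower_sfGain {n m : ℕ} (J : Fin N → Fin N → Matrix (Fin m) (Fin n) ℝ)
    (G : Fin N → Fin N → Matrix (Fin n) (Fin n) ℝ) : IsBlockLower (sfGain J G) := by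
  rw [sfGain, Matrix.mul_assoc (matT N ⊗ₖ _)]
  exact IsBlockUpper.isBlockLower_matT_mul_mul_matT
    ((isBlockUpper_blockUpper J).mul (isBlockUpper_blockUpper G).inv)

variable {m p : ℕ}

theorem isBlockLower_gainMatrix (N : ℕ) (F : ℕ → ℕ → Matrix (Fin m) (Fin p) ℝ) :
    IsBlockLower (gainMatrix N F) :=
  fun _ _ hrc => if_neg hrc.not_ge

theorem gainMatrix_mulVec_stack (F : ℕ → ℕ → Matrix (Fin m) (Fin p) ℝ) (y : ℕ → Fin p → ℝ) :
    gainMatrix N F *ᵥ stack N y =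
      stack N fun k => ∑ i ∈ Finset.range (k + 1), F k i *ᵥ y (k - i) := by
  ext ⟨r, a⟩
  have hentry (c : Fin N) (b : Fin p) :
      gainMatrix N F (r, a) (c, b) = if c ≤ r then F r (r - c) a b else 0 := rfl
  calc _ = ∑ c : Fin N, if (c : ℕ) ∈ Finset.range (r + 1) then (F r (r - c) *ᵥ y c) a else 0 := by
        simp only [mulVec, dotProduct, Fintype.sum_prod_type, hentry, Finset.mem_range_succ_iff]
        refine Finset.sum_congr rfl fun c _ => ?_
        by_cases h : (c : ℕ) ≤ r <;>
          simp only [Fin.le_def, h, if_true, if_false, stack, zero_mul, Finset.sum_const_zero]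
    _ = ∑ c ∈ Finset.range (r + 1), (F r (r - c) *ᵥ y c) a := by
        rw [Fin.sum_univ_eq_sum_range
          (fun c => if c ∈ Finset.range (r + 1) then (F r (r - c) *ᵥ y c) a else 0),
          Finset.sum_ite_mem, Finset.inter_eq_right.2 (Finset.range_subset_range.2 r.2)]
    _ = ∑ i ∈ Finset.range (r + 1), (F r i *ᵥ y (r - i)) a := by
        rw [← Finset.sum_range_reflect]
        refine Finset.sum_congr rfl fun i hi => ?_
        rw [Nat.add_sub_cancel, Nat.sub_sub_self (Finset.mem_range_succ_iff.1 hi)]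
    _ = _ := (Finset.sum_apply ..).symm

end BlockTriangular

/-! ### Stability of the periodic system -/

section Periodic

variable {n m p N : ℕ} {A : Matrix (Fin n) (Fin n) ℝ} {B : Matrix (Fin n) (Fin m) ℝ}
  {C : Matrix (Fin p) (Fin n) ℝ} {F : ℕ → ℕ → Matrix (Fin m) (Fin p) ℝ} {k₀ : ℕ}
  {x : ℕ → Fin n → ℝ}

theorem IsTrajectory.mono (hx : IsTrajectory N A B C F k₀ x) {k₁ : ℕ} (h : k₀ ≤ k₁) :
    IsTrajectory N A B C F k₁ x :=
  fun k hk => hx k (h.trans hk)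

theorem IsTrajectory.isClosedLoop (hx : IsTrajectory N A B C F k₀ x) {t : ℕ} (ht : k₀ ≤ t * N) :
    IsClosedLoop A B C (gainMatrix N F) (fun k => x (t * N + k))
      fun k => ∑ i ∈ Finset.range (k + 1), F k i *ᵥ C *ᵥ x (t * N + (k - i)) := by
  refine ⟨fun k hk => ?_, by rw [gainMatrix_mulVec_stack]⟩
  have hmod : (t * N + k) % N = k := by
    rw [Nat.mul_add_mod_self_right, Nat.mod_eq_of_lt hk]
  have hstep := hx (t * N + k) (by lia)
  rw [hmod] at hstep
  refine hstep.trans ?_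
  congr 2
  refine Finset.sum_congr rfl fun i hi => ?_
  rw [Nat.add_sub_assoc (Finset.mem_range_succ_iff.1 hi)]

theorem IsTrajectory.ltiMatrix_mulVec (hx : IsTrajectory N A B C F k₀ x) {t : ℕ}
    (ht : k₀ ≤ t * N) : ltiMatrix A B C (gainMatrix N F) *ᵥ x (t * N) = x ((t + 1) * N) := by
  rw [add_one_mul]
  exact (hx.isClosedLoop ht).ltiMatrix_mulVec (isBlockLower_gainMatrix N F)

open scoped Matrix.Norms.Operator in
theorem exists_norm_step_le (hN : 1 ≤ N) (A : Matrix (Fin n) (Fin n) ℝ)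
    (B : Matrix (Fin n) (Fin m) ℝ) (C : Matrix (Fin p) (Fin n) ℝ)
    (F : ℕ → ℕ → Matrix (Fin m) (Fin p) ℝ) :
    ∃ K : ℝ, 1 ≤ K ∧ ∀ k₀ x, IsTrajectory N A B C F k₀ x → ∀ k, k₀ ≤ k → ∀ c,
      (∀ i ≤ k % N, ‖x (k - i)‖ ≤ c) → ‖x (k + 1)‖ ≤ K * c := by
  let L (r : ℕ) : ℝ := ‖A‖ + ‖B‖ * ∑ i ∈ Finset.range (r + 1), ‖F r i‖ * ‖C‖
  have hL (r : ℕ) : 0 ≤ L r := by positivity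
  refine ⟨1 + ∑ r ∈ Finset.range N, L r,
    le_add_of_nonneg_right (Finset.sum_nonneg fun r _ => hL r), fun k₀ x hx k hk c hc => ?_⟩
  have hc0 : 0 ≤ c := (norm_nonneg _).trans (hc 0 (Nat.zero_le _))
  have hL_le : L (k % N) ≤ 1 + ∑ r ∈ Finset.range N, L r :=
    (Finset.single_le_sum (fun r _ => hL r) (Finset.mem_range.2 (Nat.mod_lt k hN))).trans
      (le_add_of_nonneg_left zero_le_one)
  have hinput : ‖∑ i ∈ Finset.range (k % N + 1), F (k % N) i *ᵥ C *ᵥ x (k - i)‖ ≤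
      ∑ i ∈ Finset.range (k % N + 1), ‖F (k % N) i‖ * (‖C‖ * c) := by
    refine norm_sum_le_of_le _ fun i hi => (linfty_opNorm_mulVec _ _).trans ?_
    gcongr
    refine (linfty_opNorm_mulVec _ _).trans ?_
    gcongr
    exact hc i (Finset.mem_range_succ_iff.1 hi)
  calc ‖x (k + 1)‖ ≤ ‖A‖ * c +
        ‖B‖ * ∑ i ∈ Finset.range (k % N + 1), ‖F (k % N) i‖ * (‖C‖ * c) := by
        rw [hx k hk]
        refine norm_add_le_of_le ((linfty_opNorm_mulVec _ _).trans ?_)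
          ((linfty_opNorm_mulVec _ _).trans ?_)
        · gcongr
          exact hc 0 (Nat.zero_le _)
        · gcongr
    _ = L (k % N) * c := by
        simp only [L, ← mul_assoc, ← Finset.sum_mul]
        ring
    _ ≤ _ := by gcongr

theorem exists_norm_le_over_period (hN : 1 ≤ N) (A : Matrix (Fin n) (Fin n) ℝ)
    (B : Matrix (Fin n) (Fin m) ℝ) (C : Matrix (Fin p) (Fin n) ℝ)
    (F : ℕ → ℕ → Matrix (Fin m) (Fin p) ℝ) :
    ∃ K : ℝ, 0 < K ∧ ∀ k₀ x, IsTrajectory N A B C F k₀ x → ∀ t, t * N ≤ k₀ → ∀ c,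
      (∀ k ∈ Set.Icc (t * N) k₀, ‖x k‖ ≤ c) →
        ∀ k ∈ Set.Icc (t * N) ((t + 1) * N), ‖x k‖ ≤ K * c := by
  obtain ⟨K, hK, hstep⟩ := exists_norm_step_le hN A B C F
  refine ⟨K ^ N, by positivity, fun k₀ x hx t ht c hc => ?_⟩
  have hc0 : 0 ≤ c := (norm_nonneg _).trans (hc _ (Set.left_mem_Icc.2 ht))
  have hgrowth (j : ℕ) (hj : j ≤ N) : ∀ i ≤ j, ‖x (t * N + i)‖ ≤ K ^ j * c := by
    induction j with
    | zero =>
      intro i hi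
      obtain rfl := Nat.le_zero.1 hi
      simpa using hc _ (Set.left_mem_Icc.2 ht)
    | succ j ih =>
      intro i hi
      have ih := ih (by lia)
      rcases Nat.le_or_eq_of_le_succ hi with hi | rfl
      · exact (ih i hi).trans (mul_le_mul_of_nonneg_right (pow_le_pow_right₀ hK j.le_succ) hc0)
      rcases le_or_gt (t * N + (j + 1)) k₀ with hk | hk
      · exact (hc _ ⟨by lia, hk⟩).trans (le_mul_of_one_le_left hc0 (one_le_pow₀ hK))
      · have hmod : (t * N + j) % N = j := by
          rw [Nat.mul_add_mod_self_right, Nat.mod_eq_of_lt (by lia)]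
        rw [pow_succ', mul_assoc]
        refine hstep k₀ x hx (t * N + j) (by lia) _ fun i hi => ?_
        rw [hmod] at hi
        rw [Nat.add_sub_assoc hi]
        exact ih _ (j.sub_le i)
  rintro k ⟨hk, hk'⟩
  obtain ⟨i, rfl⟩ := Nat.exists_eq_add_of_le hk
  exact hgrowth N le_rfl i (by lia)

theorem IsTrajectory.ltiMatrix_mulVec_add (hx : IsTrajectory N A B C F k₀ x) {T : ℕ}
    (hT : k₀ ≤ T * N) (t : ℕ) :
    x ((t + 1 + T) * N) = ltiMatrix A B C (gainMatrix N F) *ᵥ x ((t + T) * N) := by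
  rw [hx.ltiMatrix_mulVec (hT.trans (Nat.mul_le_mul_right N (Nat.le_add_left T t))),
    add_right_comm]

theorem exists_norm_le_mul_norm_div_mul (hN : 1 ≤ N) (A : Matrix (Fin n) (Fin n) ℝ)
    (B : Matrix (Fin n) (Fin m) ℝ) (C : Matrix (Fin p) (Fin n) ℝ)
    (F : ℕ → ℕ → Matrix (Fin m) (Fin p) ℝ) :
    ∃ K : ℝ, 0 < K ∧ ∀ k₀ x, IsTrajectory N A B C F k₀ x → ∀ k, k₀ ≤ k / N * N →
      ‖x k‖ ≤ K * ‖x (k / N * N)‖ := by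
  obtain ⟨K, hK, hbound⟩ := exists_norm_le_over_period hN A B C F
  refine ⟨K, hK, fun k₀ x hx k hk => hbound _ x (hx.mono hk) (k / N) le_rfl _ (fun i hi => ?_) k
    ⟨Nat.div_mul_le_self k N, ?_⟩⟩
  · rw [Set.Icc_self, Set.mem_singleton_iff] at hi
    rw [hi]
  · rw [add_one_mul]
    exact (Nat.lt_div_mul_add hN).le

theorem exists_norm_lt_over_period (hN : 1 ≤ N) (A : Matrix (Fin n) (Fin n) ℝ)
    (B : Matrix (Fin n) (Fin m) ℝ) (C : Matrix (Fin p) (Fin n) ℝ)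
    (F : ℕ → ℕ → Matrix (Fin m) (Fin p) ℝ) (k₀ : ℕ) {ε : ℝ} (hε : 0 < ε) :
    ∃ δ > 0, ∀ x, IsTrajectory N A B C F k₀ x → (∀ i ≤ k₀ % N, ‖x (k₀ - i)‖ < δ) →
      ∀ k ∈ Set.Icc (k₀ / N * N) ((k₀ / N + 1) * N), ‖x k‖ < ε := by
  obtain ⟨K, hK, hbound⟩ := exists_norm_le_over_period hN A B C F
  refine ⟨ε / (2 * K), by positivity, fun x hx hdata k hk => ?_⟩
  have hpast (i : ℕ) (hi : i ∈ Set.Icc (k₀ / N * N) k₀) : ‖x i‖ ≤ ε / (2 * K) := by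
    have := hdata (k₀ - i) (by have := Nat.mod_add_div' k₀ N; grind)
    rw [Nat.sub_sub_self hi.2] at this
    exact this.le
  calc ‖x k‖ ≤ K * (ε / (2 * K)) :=
        hbound k₀ x hx (k₀ / N) (Nat.div_mul_le_self k₀ N) _ hpast k hk
    _ = ε / 2 := by field_simp
    _ < ε := half_lt_self hε

theorem IsTrajectory.tendsto_zero (hN : 1 ≤ N)
    (hLTI : LTIAsympStable (ltiMatrix A B C (gainMatrix N F)))
    (hx : IsTrajectory N A B C F k₀ x) : Tendsto x atTop (𝓝 0) := by
  obtain ⟨K, -, hlate⟩ := exists_norm_le_mul_norm_div_mul hN A B C F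
  have hφ_lim : Tendsto (fun t => x ((t + k₀) * N)) atTop (𝓝 0) :=
    hLTI.2 _ (hx.ltiMatrix_mulVec_add (Nat.le_mul_of_pos_right k₀ hN))
  have hdiv : Tendsto (fun k => k / N) atTop atTop :=
    Nat.tendsto_div_const_atTop (Nat.one_le_iff_ne_zero.1 hN)
  have hstart : Tendsto (fun k => x (k / N * N)) atTop (𝓝 0) :=
    ((tendsto_add_atTop_iff_nat (f := fun t => x (t * N)) k₀).1 hφ_lim).comp hdiv
  refine squeeze_zero_norm' ?_ (by simpa using hstart.norm.const_mul K)
  filter_upwards [hdiv.eventually_ge_atTop k₀] with k hk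
  exact hlate k₀ x hx k (hk.trans (Nat.le_mul_of_pos_right _ hN))

theorem periodicAsympStable_of_lti (hN : 1 ≤ N)
    (hLTI : LTIAsympStable (ltiMatrix A B C (gainMatrix N F))) :
    PeriodicAsympStable N A B C F := by
  refine fun k₀ => ⟨fun ε hε => ?_, fun x hx => hx.tendsto_zero hN hLTI⟩
  obtain ⟨K, hK, hlate⟩ := exists_norm_le_mul_norm_div_mul hN A B C F
  obtain ⟨δ, hδ, hstable⟩ := hLTI.1 (ε / K) (by positivity)
  obtain ⟨η, hη, hearly⟩ := exists_norm_lt_over_period hN A B C F k₀ (lt_min hε hδ)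
  let T := k₀ / N + 1
  have hT : k₀ ≤ T * N := (Nat.lt_div_mul_add hN).le.trans_eq (Nat.succ_mul _ _).symm
  refine ⟨η, hη, fun x hx hdata k hk => ?_⟩
  have hearly := hearly x hx hdata
  rcases le_total k (T * N) with hkT | hkT
  · exact (hearly k ⟨(Nat.div_mul_le_self k₀ N).trans hk, hkT⟩).trans_le (min_le_left ..)
  · have hT_le : T ≤ k / N := (Nat.le_div_iff_mul_le hN).2 hkT
    have hφ0 : ‖x ((0 + T) * N)‖ < δ := by
      rw [zero_add]
      exact (hearly _ ⟨Nat.mul_le_mul_right N (Nat.le_succ _), le_rfl⟩).trans_le (min_le_right ..)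
    have hφ := hstable (fun t => x ((t + T) * N)) (hx.ltiMatrix_mulVec_add hT) hφ0 (k / N - T)
    beta_reduce at hφ
    rw [Nat.sub_add_cancel hT_le] at hφ
    exact (hlate k₀ x hx k (hT.trans (Nat.mul_le_mul_right N hT_le))).trans_lt
      ((lt_div_iff₀' hK).1 hφ)

end Periodic

end PeriodicSOF

theorem corollary1_general (n m p N : ℕ) (hN : 1 ≤ N)
    (A : Matrix (Fin n) (Fin n) ℝ) (B : Matrix (Fin n) (Fin m) ℝ) (C : Matrix (Fin p) (Fin n) ℝ)
    (Fhat : Matrix (Fin N × Fin m) (Fin N × Fin n) ℝ)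
    (hFhat : IsBlockLower Fhat)
    (hne : (lyapunovSet (ltiMatrix A B (1 : Matrix (Fin n) (Fin n) ℝ) Fhat) ∩
      lyapunovUnion N A B C).Nonempty) :
    ((∃ F : ℕ → ℕ → Matrix (Fin m) (Fin p) ℝ, PeriodicAsympStable N A B C F) ↔
      ∃ (F : ℕ → ℕ → Matrix (Fin m) (Fin p) ℝ) (P : Matrix (Fin n) (Fin n) ℝ)
        (V : Matrix ((Fin N × Fin m) ⊕ (Fin (N - 1) × Fin n))
          ((Fin N × Fin m) ⊕ (Fin (N - 1) × Fin n)) ℝ),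
        SynthesisBMI A B C Fhat P V (gainMatrix N F)) ∧
    ((∃ F : ℕ → ℕ → Matrix (Fin m) (Fin p) ℝ,
        LTIAsympStable (ltiMatrix A B C (gainMatrix N F))) ↔
      ∃ (F : ℕ → ℕ → Matrix (Fin m) (Fin p) ℝ) (P : Matrix (Fin n) (Fin n) ℝ)
        (V : Matrix ((Fin N × Fin m) ⊕ (Fin (N - 1) × Fin n))
          ((Fin N × Fin m) ⊕ (Fin (N - 1) × Fin n)) ℝ),
        SynthesisBMI A B C Fhat P V (gainMatrix N F)) ∧
    (∀ (F : ℕ → ℕ → Matrix (Fin m) (Fin p) ℝ) (P : Matrix (Fin n) (Fin n) ℝ)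
        (V : Matrix ((Fin N × Fin m) ⊕ (Fin (N - 1) × Fin n))
          ((Fin N × Fin m) ⊕ (Fin (N - 1) × Fin n)) ℝ),
        SynthesisBMI A B C Fhat P V (gainMatrix N F) →
          PeriodicAsympStable N A B C F ∧ LTIAsympStable (ltiMatrix A B C (gainMatrix N F))) := by
  have hstable (F P V) (h : SynthesisBMI A B C Fhat P V (gainMatrix N F)) :
      PeriodicAsympStable N A B C F ∧ LTIAsympStable (ltiMatrix A B C (gainMatrix N F)) := by
    have hLTI := ltiAsympStable_of_mem_lyapunovSet
      ((exists_synthesisBMI_iff hN (isBlockLower_gainMatrix N F) hFhat).1 ⟨V, h⟩).2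
    exact ⟨periodicAsympStable_of_lti hN hLTI, hLTI⟩
  have hsolvable : ∃ F P V, SynthesisBMI A B C Fhat P V (gainMatrix N F) := by
    obtain ⟨P, hP_sf, hP_sof⟩ := hne
    obtain ⟨_, ⟨⟨F, rfl⟩, -⟩, hP⟩ := Set.mem_iUnion₂.1 hP_sof
    exact ⟨F, P, (exists_synthesisBMI_iff hN (isBlockLower_gainMatrix N F) hFhat).2 ⟨hP_sf, hP⟩⟩
  exact ⟨⟨fun _ => hsolvable, fun ⟨F, P, V, h⟩ => ⟨F, (hstable F P V h).1⟩⟩,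
    ⟨fun _ => hsolvable, fun ⟨F, P, V, h⟩ => ⟨F, (hstable F P V h).2⟩⟩, hstable⟩

theorem corollary1 (n m p N : ℕ) (hN : 1 ≤ N)
    (A : Matrix (Fin n) (Fin n) ℝ) (B : Matrix (Fin n) (Fin m) ℝ) (C : Matrix (Fin p) (Fin n) ℝ)
    (Phat : Matrix (Fin n) (Fin n) ℝ)
    (Jhat : Fin N → Fin N → Matrix (Fin m) (Fin n) ℝ)
    (Ghat : Fin N → Fin N → Matrix (Fin n) (Fin n) ℝ)
    (Fhat : Matrix (Fin N × Fin m) (Fin N × Fin n) ℝ)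
    (hLMI : EbiharaLMI A B Phat Jhat Ghat)
    (hFhat : Fhat = sfGain Jhat Ghat)
    (hne : (lyapunovSet (ltiMatrix A B (1 : Matrix (Fin n) (Fin n) ℝ) Fhat) ∩
      lyapunovUnion N A B C).Nonempty) :
    -- the equivalence for the periodic control system
    ((∃ F : ℕ → ℕ → Matrix (Fin m) (Fin p) ℝ, PeriodicAsympStable N A B C F) ↔
      ∃ (F : ℕ → ℕ → Matrix (Fin m) (Fin p) ℝ) (P : Matrix (Fin n) (Fin n) ℝ)
        (V : Matrix ((Fin N × Fin m) ⊕ (Fin (N - 1) × Fin n))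
          ((Fin N × Fin m) ⊕ (Fin (N - 1) × Fin n)) ℝ),
        SynthesisBMI A B C Fhat P V (gainMatrix N F)) ∧
    -- the equivalence for the LTI system
    ((∃ F : ℕ → ℕ → Matrix (Fin m) (Fin p) ℝ,
        LTIAsympStable (ltiMatrix A B C (gainMatrix N F))) ↔
      ∃ (F : ℕ → ℕ → Matrix (Fin m) (Fin p) ℝ) (P : Matrix (Fin n) (Fin n) ℝ)
        (V : Matrix ((Fin N × Fin m) ⊕ (Fin (N - 1) × Fin n))
          ((Fin N × Fin m) ⊕ (Fin (N - 1) × Fin n)) ℝ),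
        SynthesisBMI A B C Fhat P V (gainMatrix N F)) ∧
    -- a gain matrix with which the inequalities are satisfied is itself stabilizing
    (∀ (F : ℕ → ℕ → Matrix (Fin m) (Fin p) ℝ) (P : Matrix (Fin n) (Fin n) ℝ)
        (V : Matrix ((Fin N × Fin m) ⊕ (Fin (N - 1) × Fin n))
          ((Fin N × Fin m) ⊕ (Fin (N - 1) × Fin n)) ℝ),
        SynthesisBMI A B C Fhat P V (gainMatrix N F) →
          PeriodicAsympStable N A B C F ∧ LTIAsympStable (ltiMatrix A B C (gainMatrix N F))) := by
  subst hFhat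
  exact corollary1_general n m p N hN A B C _ (isBlockLower_sfGain Jhat Ghat) hne
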